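/- For a simple graph $H$, let $\mathrm{Hom}_p(K_2,H)$ be the set of pairs $(A_1,A_2)$ of non-empty subsets of $V(H)$ such that every vertex of $A_1$ is adjacent in $H$ to every vertex of $A_2$, ordered by $(A_1,A_2)\le(B_1,B_2)$ iff $A_1\subseteq B_1$ and $A_2\subseteq B_2$. The group $\mathbb{Z}_2=\{e,\omega\}$ acts on it by $\omega\cdot(A_1,A_2)=(A_2,A_1)$. Let $C_{\mathrm{Hom}(K_2,H)}$ be the graph with vertex set $\mathrm{Hom}_p(K_2,H)$ in which $x$ and $y$ are adjacent iff $x$ and $\omega\cdot y$ are comparable, that is, $x\le\omega\cdot y$ or $\omega\cdot y\le x$. Let $KG(n,k)$ be the Kneser graph, whose vertices are the $k$-element subsets of $\{1,\dots,n\}$, two of them being adjacent iff they are disjoint, and let $\chi$ denote the chromatic number. Let $k\ge 1$ be an integer. For every integer $n\ge 2k$, $$\chi\bigl(C_{\mathrm{Hom}(K_2,KG(n,k))}\bigr)=n-2k+2.$$ In particular (Kneser's conjecture), for every integer $n\ge 2k-1$, $$\chi\bigl(KG(n,k)\bigr)=n-2k+2.$$ -/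

import Mathlib

/-- The Hom poset `Hom_p(F, H)`: families `(A i)`, indexed by the vertices of `F`, of non-empty
sets of vertices of `H` such that `A i × A j ⊆ E(H)` for every edge `(i, j)` of `F`. -/
def HomPoset {V W : Type*} (F : SimpleGraph V) (H : SimpleGraph W) : Type _ :=
  {A : V → Set W // (∀ i, (A i).Nonempty) ∧
    ∀ i j, F.Adj i j → ∀ a ∈ A i, ∀ b ∈ A j, H.Adj a b}

/-- The order of the Hom poset: `A ≤ B` iff `A i ⊆ B i` for all `i`. -/
instance HomPoset.instPartialOrder {V W : Type*} (F : SimpleGraph V) (H : SimpleGraph W) :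
    PartialOrder (HomPoset F H) :=
  inferInstanceAs (PartialOrder {A : V → Set W // (∀ i, (A i).Nonempty) ∧
    ∀ i j, F.Adj i j → ∀ a ∈ A i, ∀ b ∈ A j, H.Adj a b})

/-- `Hom_p(K_r, H)`, where the vertices `1, …, r` of the complete graph `K_r` are labelled by their
residues modulo `r` (used for `r ≥ 1` only). -/
abbrev HomCompletePoset {W : Type*} (r : ℕ) (H : SimpleGraph W) : Type _ :=
  HomPoset (⊤ : SimpleGraph (ZMod r)) H

/-- The cyclic group `Z_r`, written multiplicatively, acts on `Hom_p(K_r, H)` by cyclic shift: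
the entry of `ω ^ i • A` at the index `j` is the entry of `A` at the index `j + i` mod `r`. -/
instance HomCompletePoset.instMulAction {W : Type*} (r : ℕ) (H : SimpleGraph W) :
    MulAction (Multiplicative (ZMod r)) (HomCompletePoset r H) where
  smul g A := ⟨fun j => A.1 (j + g.toAdd), fun _ => A.2.1 _,
    fun _ _ hij => A.2.2 _ _ (fun h => hij (add_right_cancel h))⟩
  one_smul A := Subtype.ext (funext fun j => congrArg A.1 (add_zero j))
  mul_smul g h A := Subtype.ext (funext fun j => congrArg A.1
    (show j + (g.toAdd + h.toAdd) = j + g.toAdd + h.toAdd from (add_assoc _ _ _).symm))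

/-- The cyclic shift preserves the order, so `Hom_p(K_r, H)` is a `Z_r`-poset. -/
instance HomCompletePoset.instCovariantClass {W : Type*} (r : ℕ) (H : SimpleGraph W) :
    CovariantClass (Multiplicative (ZMod r)) (HomCompletePoset r H) (· • ·) (· ≤ ·) where
  elim g _ _ hAB := fun j => hAB (j + g.toAdd)

/-- The compatibility graph `C_P` of a `G`-poset `P`: the vertices are the elements of `P`, and
`x`, `y` are adjacent iff `x` and `g • y` are comparable for some `g ≠ e` in `G`. The clause `x ≠ y`
only serves to make this a loopless graph; for `P = Hom_p(K_r, H)` it is redundant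
(see `compatibilityGraph_homCompletePoset_adj`). -/
def compatibilityGraph (G P : Type*) [Group G] [PartialOrder P] [MulAction G P]
    [CovariantClass G P (· • ·) (· ≤ ·)] : SimpleGraph P where
  Adj x y := x ≠ y ∧ ∃ g : G, g ≠ 1 ∧ (x ≤ g • y ∨ g • y ≤ x)
  symm := ⟨by
    rintro x y ⟨hne, g, hg, h⟩
    refine ⟨hne.symm, g⁻¹, inv_ne_one.mpr hg, ?_⟩
    rcases h with h | h
    · right
      have h' : g⁻¹ • x ≤ g⁻¹ • (g • y) := CovariantClass.elim g⁻¹ h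
      rwa [inv_smul_smul] at h'
    · left
      have h' : g⁻¹ • (g • y) ≤ g⁻¹ • x := CovariantClass.elim g⁻¹ h
      rwa [inv_smul_smul] at h'⟩
  loopless := ⟨fun _ h => h.1 rfl⟩

/-- The graph `C_{Hom(K_r, H)}`. -/
abbrev homCompatibilityGraph {W : Type*} (r : ℕ) (H : SimpleGraph W) :
    SimpleGraph (HomCompletePoset r H) :=
  compatibilityGraph (Multiplicative (ZMod r)) (HomCompletePoset r H)

/-- In `C_{Hom(K_r, H)}` adjacency is exactly the comparability condition: no element of
`Hom_p(K_r, H)` is comparable to a nontrivial shift of itself. -/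
theorem compatibilityGraph_homCompletePoset_adj {W : Type*} (r : ℕ) (H : SimpleGraph W)
    (x y : HomCompletePoset r H) :
    (homCompatibilityGraph r H).Adj x y ↔
      ∃ g : Multiplicative (ZMod r), g ≠ 1 ∧ (x ≤ g • y ∨ g • y ≤ x) := by
  refine ⟨fun h => h.2, fun h => ⟨?_, h⟩⟩
  rintro rfl
  obtain ⟨g, hg, h⟩ := h
  have hne : (0 : ZMod r) ≠ 0 + g.toAdd := by
    rw [zero_add]
    exact fun h0 => hg (Multiplicative.toAdd.injective h0.symm)
  rcases h with h | h
  · obtain ⟨a, ha⟩ := x.2.1 0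
    exact (x.2.2 _ _ hne a ha a (h 0 ha)).ne rfl
  · obtain ⟨a, ha⟩ := x.2.1 (0 + g.toAdd)
    exact (x.2.2 _ _ hne a (h 0 ha) a ha).ne rfl

/-- The Kneser graph `KG(n, k)`: the vertices are the `k`-element subsets of an `n`-element set, two
of them adjacent iff they are disjoint (for `k ≥ 1` the clause `s ≠ t` is redundant). -/
def kneserGraph (n k : ℕ) : SimpleGraph {s : Finset (Fin n) // s.card = k} where
  Adj s t := s ≠ t ∧ Disjoint s.1 t.1
  symm := ⟨fun _ _ h => ⟨h.1.symm, h.2.symm⟩⟩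
  loopless := ⟨fun _ h => h.1 rfl⟩

/-!
A proper colouring of a graph `H` with `m` colours gives one of `C_{Hom(K_2, H)}`: colour `A` by the
least colour occurring in `A 0`. This is proper because all of `A 0` is adjacent to all of `A 1`.
Together with the usual colouring of `KG(n, k)` this yields both upper bounds, and it reduces both
lower bounds (for `n ≥ 2k`) to that for the compatibility graph.

The lower bound rests on the octahedral Tucker lemma (`IsTuckerLabelling.exists_le_color`): if the
nonzero vectors of `{+, -, 0}ⁿ` are labelled antipodally by signed colours so that comparable
vectors never get opposite labels, then at least `n` colours occur in a chain. Given a proper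
`m`-colouring `c` of `C_{Hom(K_2, KG(n, k))}`, a vector `(P, N)` whose supports both have at least
`k` elements determines the pair of the families of `k`-subsets of `P` and of `N`. This pair is
adjacent to its swap, so its label can be the smaller of their two colours, with a sign telling
which of the two it belongs to. Comparable vectors with opposite labels would be adjacent elements
of equal colour, and only `m - 1` colours are used, as the smaller of two distinct colours is not
the largest. The remaining vectors need `2k - 1` further colours (`kneserLabel`), so
`n ≤ (2k - 1) + (m - 1)`.

Tucker's lemma is proved by Fan's parity argument. Call a set of labels alternating if its signs
alternate when it is sorted by colour. Summed over the facets of a simplex, the indicator of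
alternation with first sign `+` gives, modulo 2, the indicator of alternation with either first sign
(`sum_altMultiset_erase`). The boundary of a hemisphere consists of a hemisphere of one dimension
less and its antipode, so the parity of the number of alternating maximal flags is the same for
hemispheres of all dimensions, and it is odd for a point (`sum_altMultiset_hemisphereFlags`). The
colours in an alternating flag are distinct.
-/

/-! ### Alternating labels -/

/-- Reversal of the sign of a label. A label is a colour together with a sign, and labels are
ordered by colour first. -/
def flipSign (x : ℕ ×ₗ Bool) : ℕ ×ₗ Bool := toLex ((ofLex x).1, !(ofLex x).2)

theorem flipSign_flipSign (x : ℕ ×ₗ Bool) : flipSign (flipSign x) = x := by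
  simp [flipSign]

/-- The indicator, with values in `ZMod 2`, of the lists of labels whose signs alternate and begin
with the sign `b`. -/
def altList : Bool → List (ℕ ×ₗ Bool) → ZMod 2
  | _, [] => 1
  | b, x :: l => if (ofLex x).2 = b then altList (!b) l else 0

theorem sum_altList_erase (l : List (ℕ ×ₗ Bool)) (hl : l.Pairwise (· ≤ ·)) (b : Bool) :
    (l.map fun x => altList b (l.erase x)).sum = altList b l + altList (!b) l := by
  induction l generalizing b with
  | nil => simp only [altList, List.map_nil, List.sum_nil]; decide
  | cons a l ih =>
    have hl' := List.pairwise_cons.mp hl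
    -- In a sorted list the copies of `a` come first, so erasing any of them deletes the head.
    have key : ∀ x ∈ l, (a :: l).erase x = a :: l.erase x := by
      intro x hx
      by_cases hxa : x = a
      · subst hxa
        cases l with
        | nil => simp at hx
        | cons y l =>
          have hy : y = x := by
            apply le_antisymm _ (hl'.1 y (by simp))
            rcases List.mem_cons.mp hx with h | h
            · exact h.ge
            · exact (List.pairwise_cons.mp hl'.2).1 x h
          subst hy
          simp
      · rw [List.erase_cons_tail]
        simpa using fun h => hxa h.symm
    have h1 : l.map (fun x => altList b ((a :: l).erase x))
        = l.map (fun x => altList b (a :: l.erase x)) :=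
      List.map_congr_left fun x hx => by rw [key x hx]
    rw [List.map_cons, List.sum_cons, h1, List.erase_cons_head]
    by_cases hb : (ofLex a).2 = b
    · have hb' : ¬ (ofLex a).2 = !b := by simp [hb]
      simp only [altList, if_pos hb, if_neg hb']
      rw [ih hl'.2, Bool.not_not, add_zero, add_comm, add_assoc, CharTwo.add_self_eq_zero,
        add_zero]
    · have hb' : (ofLex a).2 = !b := by
        cases h : (ofLex a).2 <;> cases b <;> simp_all
      simp only [altList, if_neg hb, if_pos hb']
      simp

/-- The indicator of the multisets of labels whose signs alternate, beginning with `b`, when the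
labels are sorted by colour. -/
def altMultiset (b : Bool) (M : Multiset (ℕ ×ₗ Bool)) : ZMod 2 := altList b (M.sort (· ≤ ·))

/-- Alternation is a cochain whose coboundary is its own symmetrization: an odd number of the
facets of a nonempty simplex alternate beginning with `b` exactly if the simplex itself alternates,
beginning with either sign. -/
theorem sum_altMultiset_erase (b : Bool) (M : Multiset (ℕ ×ₗ Bool)) :
    (M.map fun x => altMultiset b (M.erase x)).sum = altMultiset b M + altMultiset (!b) M := by
  have hs : (M.sort (· ≤ ·)).Pairwise (· ≤ ·) := Multiset.pairwise_sort M (· ≤ ·)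
  have h := sum_altList_erase _ hs b
  unfold altMultiset
  rw [← h]
  conv_lhs => enter [1, 2]; rw [← Multiset.sort_eq M (· ≤ ·)]
  rw [Multiset.map_coe, Multiset.sum_coe]
  congr 1
  apply List.map_congr_left
  intro x _
  congr 1
  conv_lhs => rw [← Multiset.sort_eq M (· ≤ ·)]
  rw [Multiset.coe_erase]
  refine List.Perm.eq_of_pairwise' (r := (· ≤ ·)) (Multiset.pairwise_sort _ _)
    (hs.sublist List.erase_sublist) ?_
  rw [← Multiset.coe_eq_coe, Multiset.sort_eq]
  -- Only the two instances of `BEq` on labels differ.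
  congr 2
  exact lawful_beq_subsingleton _ _

theorem altList_map_flipSign (b : Bool) (l : List (ℕ ×ₗ Bool)) :
    altList b (l.map flipSign) = altList (!b) l := by
  induction l generalizing b with
  | nil => rfl
  | cons a l ih =>
    simp only [List.map_cons, altList, ih]
    congr 1
    simp [flipSign, Bool.not_eq_eq_eq_not]

theorem flipSign_le_flipSign {x y : ℕ ×ₗ Bool} (h : x ≤ y) (hne : y ≠ flipSign x) :
    flipSign x ≤ flipSign y := by
  rw [Prod.Lex.le_iff] at h ⊢
  rcases h with h | ⟨h, h'⟩
  · exact Or.inl h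
  · right
    refine ⟨h, ?_⟩
    have : (ofLex y).2 ≠ !(ofLex x).2 := by
      intro h2
      apply hne
      apply ofLex.injective
      exact Prod.ext h.symm h2
    have h3 : (ofLex y).2 = (ofLex x).2 := by
      cases h4 : (ofLex y).2 <;> cases h5 : (ofLex x).2 <;> simp_all
    simp [flipSign, h3]

theorem altMultiset_map_flipSign (b : Bool) (M : Multiset (ℕ ×ₗ Bool))
    (hM : ∀ x ∈ M, ∀ y ∈ M, y ≠ flipSign x) :
    altMultiset b (M.map flipSign) = altMultiset (!b) M := by
  unfold altMultiset
  rw [← altList_map_flipSign]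
  congr 1
  refine List.Perm.eq_of_pairwise' (r := (· ≤ ·)) (Multiset.pairwise_sort _ _) ?_ ?_
  · rw [List.pairwise_map]
    refine (Multiset.pairwise_sort M (· ≤ ·)).imp_of_mem ?_
    intro x y hx hy hxy
    exact flipSign_le_flipSign hxy (hM x (by simpa using hx) y (by simpa using hy))
  · rw [← Multiset.coe_eq_coe, Multiset.sort_eq, ← Multiset.map_coe, Multiset.sort_eq]

theorem pairwise_color_lt_of_altList_ne_zero (b : Bool) (l : List (ℕ ×ₗ Bool))
    (hl : l.Pairwise (· ≤ ·)) (hc : ∀ x ∈ l, ∀ y ∈ l, y ≠ flipSign x) (h : altList b l ≠ 0) :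
    (l.map fun x => (ofLex x).1).Pairwise (· < ·) := by
  induction l generalizing b with
  | nil => simp
  | cons a l ih =>
    have hl' := List.pairwise_cons.mp hl
    have hb : (ofLex a).2 = b := by
      by_contra hb
      simp [altList, hb] at h
    have h' : altList (!b) l ≠ 0 := by simpa [altList, hb] using h
    have ih' := ih (!b) hl'.2
      (fun x hx y hy => hc x (List.mem_cons_of_mem _ hx) y (List.mem_cons_of_mem _ hy)) h'
    cases l with
    | nil => simp
    | cons y l =>
      have hy : (ofLex y).2 = !b := by
        by_contra hy
        simp [altList, hy] at h'
      have hay : (ofLex a).1 < (ofLex y).1 := by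
        rcases Prod.Lex.le_iff.mp (hl'.1 y (by simp)) with h1 | ⟨h1, _⟩
        · exact h1
        · exfalso
          refine hc a (by simp) y (by simp) (ofLex.injective (Prod.ext h1.symm ?_))
          simp [flipSign, hy, hb]
      simp only [List.map_cons] at ih' ⊢
      refine List.pairwise_cons.mpr ⟨?_, ih'⟩
      intro z hz
      rcases List.mem_cons.mp hz with rfl | hz
      · exact hay
      · exact hay.trans ((List.pairwise_cons.mp ih').1 z hz)

/-- Sorted by colour, alternating labels without complementary pairs have distinct colours. -/
theorem exists_card_le_color_of_altMultiset_ne_zero (b : Bool) (M : Multiset (ℕ ×ₗ Bool))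
    (hM : ∀ x ∈ M, ∀ y ∈ M, y ≠ flipSign x) (h : altMultiset b M ≠ 0) (h0 : M ≠ 0) :
    ∃ x ∈ M, Multiset.card M ≤ (ofLex x).1 + 1 := by
  by_contra! hlt
  have hp := pairwise_color_lt_of_altList_ne_zero b (M.sort (· ≤ ·))
    (Multiset.pairwise_sort _ _)
    (fun x hx y hy => hM x (by simpa using hx) y (by simpa using hy)) h
  have hnd : ((M.sort (· ≤ ·)).map fun x => (ofLex x).1).Nodup := hp.imp fun h => h.ne
  have hcard := List.toFinset_card_of_nodup hnd
  have hsub : ((M.sort (· ≤ ·)).map fun x => (ofLex x).1).toFinset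
      ⊆ Finset.range (Multiset.card M - 1) := by
    intro j hj
    obtain ⟨x, hx, rfl⟩ : ∃ x ∈ M, (ofLex x).1 = j := by simpa using hj
    have := hlt x hx
    rw [Finset.mem_range]
    omega
  have hle := Finset.card_le_card hsub
  rw [hcard, List.length_map, Multiset.length_sort, Finset.card_range] at hle
  have := Multiset.card_pos.mpr h0
  omega

/-! ### Flags of signed sets -/

/-- A nonzero sign vector in `{+, -, 0}ⁿ`, encoded by its positive and its negative support. The
antipode is `Prod.swap` and the face order is componentwise inclusion. -/
def IsSignVector {n : ℕ} (X : Finset (Fin n) × Finset (Fin n)) : Prop :=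
  Disjoint X.1 X.2 ∧ (X.1 ∪ X.2).Nonempty

/-- The sign vector with the signs of `s` on the first `i + 1` coordinates in the order `σ`, and
zero elsewhere. For fixed `σ` and `s` these form a maximal flag. -/
def flagFace {n : ℕ} (σ : Equiv.Perm (Fin n)) (s : Fin n → Bool) (i : Fin n) :
    Finset (Fin n) × Finset (Fin n) :=
  (Finset.univ.filter fun a => σ.symm a ≤ i ∧ s a = true,
    Finset.univ.filter fun a => σ.symm a ≤ i ∧ s a = false)

theorem isSignVector_flagFace {n : ℕ} (σ : Equiv.Perm (Fin n)) (s : Fin n → Bool) (i : Fin n) :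
    IsSignVector (flagFace σ s i) := by
  constructor
  · rw [Finset.disjoint_left]
    intro a ha hb
    simp only [flagFace, Finset.mem_filter, Finset.mem_univ, true_and] at ha hb
    simp [ha.2] at hb
  · refine ⟨σ i, ?_⟩
    cases h : s (σ i) <;> simp [flagFace, h]

theorem flagFace_mono {n : ℕ} (σ : Equiv.Perm (Fin n)) (s : Fin n → Bool) :
    Monotone (flagFace σ s) := by
  intro i j hij
  constructor <;>
  · intro a ha
    simp only [flagFace, Finset.mem_filter, Finset.mem_univ, true_and] at ha ⊢
    exact ⟨ha.1.trans hij, ha.2⟩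

theorem flagFace_congr {n : ℕ} {σ τ : Equiv.Perm (Fin n)} {s t : Fin n → Bool} {i : Fin n}
    (hστ : ∀ a, σ.symm a ≤ i ↔ τ.symm a ≤ i) (hst : ∀ a, σ.symm a ≤ i → s a = t a) :
    flagFace σ s i = flagFace τ t i := by
  unfold flagFace
  congr 1 <;>
  · ext a
    simp only [Finset.mem_filter, Finset.mem_univ, true_and, ← hστ]
    exact and_congr_right fun h => by rw [hst a h]

theorem flagFace_swap {n : ℕ} {σ : Equiv.Perm (Fin n)} {s t : Fin n → Bool} {i : Fin n}
    (hst : ∀ a, σ.symm a ≤ i → t a = !s a) :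
    flagFace σ t i = (flagFace σ s i).swap := by
  unfold flagFace
  rw [Prod.swap_prod_mk]
  congr 1 <;>
  · ext a
    simp only [Finset.mem_filter, Finset.mem_univ, true_and]
    exact and_congr_right fun h => by rw [hst a h]; simp

/-- A labelling of sign vectors is a Tucker labelling if it is antipodal and comparable sign
vectors never carry opposite labels. -/
structure IsTuckerLabelling {n : ℕ} (f : Finset (Fin n) × Finset (Fin n) → ℕ ×ₗ Bool) : Prop where
  antipodal : ∀ X, IsSignVector X → f X.swap = flipSign (f X)
  not_complementary : ∀ X Y, IsSignVector X → IsSignVector Y → X ≤ Y → f Y ≠ flipSign (f X)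

/-- The labels of the faces of the flag `(σ, s)` with indices in `I`. -/
def flagLabels {n : ℕ} (f : Finset (Fin n) × Finset (Fin n) → ℕ ×ₗ Bool) (I : Finset (Fin n))
    (p : Equiv.Perm (Fin n) × (Fin n → Bool)) : Multiset (ℕ ×ₗ Bool) :=
  I.val.map fun i => f (flagFace p.1 p.2 i)

theorem flagLabels_congr {n : ℕ} {f : Finset (Fin n) × Finset (Fin n) → ℕ ×ₗ Bool}
    {I : Finset (Fin n)} {p q : Equiv.Perm (Fin n) × (Fin n → Bool)}
    (h : ∀ i ∈ I, flagFace p.1 p.2 i = flagFace q.1 q.2 i) :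
    flagLabels f I p = flagLabels f I q :=
  Multiset.map_congr rfl fun i hi => by rw [h i hi]

theorem flagLabels_not_complementary {n : ℕ} {f : Finset (Fin n) × Finset (Fin n) → ℕ ×ₗ Bool}
    (hf : IsTuckerLabelling f) (I : Finset (Fin n)) (p : Equiv.Perm (Fin n) × (Fin n → Bool)) :
    ∀ x ∈ flagLabels f I p, ∀ y ∈ flagLabels f I p, y ≠ flipSign x := by
  intro x hx y hy
  obtain ⟨i, _, rfl⟩ := Multiset.mem_map.mp hx
  obtain ⟨j, _, rfl⟩ := Multiset.mem_map.mp hy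
  rcases le_total i j with h | h
  · exact hf.not_complementary _ _ (isSignVector_flagFace ..) (isSignVector_flagFace ..)
      (flagFace_mono _ _ h)
  · intro he
    refine hf.not_complementary _ _ (isSignVector_flagFace ..) (isSignVector_flagFace ..)
      (flagFace_mono p.1 p.2 h) ?_
    rw [he, flipSign_flipSign]

/-- The alternation of a flag is the sum of the alternations of its facets. -/
theorem sum_altMultiset_flagLabels_erase {n : ℕ}
    (f : Finset (Fin n) × Finset (Fin n) → ℕ ×ₗ Bool) (I : Finset (Fin n))
    (p : Equiv.Perm (Fin n) × (Fin n → Bool)) (b : Bool) :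
    ∑ i ∈ I, altMultiset b (flagLabels f (I.erase i) p)
      = altMultiset b (flagLabels f I p) + altMultiset (!b) (flagLabels f I p) := by
  rw [← sum_altMultiset_erase, flagLabels, Multiset.map_map, Finset.sum]
  congr 1
  refine Multiset.map_congr rfl fun i hi => ?_
  have : I.val = i ::ₘ (I.erase i).val := by
    rw [Finset.erase_val, Multiset.cons_erase hi]
  simp only [Function.comp_apply]
  conv_rhs => rw [this]
  rw [Multiset.map_cons, Multiset.erase_cons_head, flagLabels]

/-- The flags, up to dimension `d - 1`, of the hemisphere of the sphere spanned by the first `d`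
coordinates in which the last of these is nonnegative. The values of `σ` and `s` on the remaining
coordinates are fixed, so each flag is listed once. -/
def hemisphereFlags (n d : ℕ) : Finset (Equiv.Perm (Fin n) × (Fin n → Bool)) :=
  {p | (∀ i : Fin n, d ≤ i → p.1 i = i) ∧ ∀ i : Fin n, d ≤ i + 1 → p.2 i = true}

theorem mem_hemisphereFlags {n d : ℕ} {p : Equiv.Perm (Fin n) × (Fin n → Bool)} :
    p ∈ hemisphereFlags n d ↔
      (∀ i : Fin n, d ≤ i → p.1 i = i) ∧ ∀ i : Fin n, d ≤ i + 1 → p.2 i = true := by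
  simp [hemisphereFlags]

/-- The first `d` indices. -/
def firstIndices (n d : ℕ) : Finset (Fin n) := {i | (i : ℕ) < d}

theorem mem_firstIndices {n d : ℕ} {i : Fin n} : i ∈ firstIndices n d ↔ (i : ℕ) < d := by
  simp [firstIndices]

/-- Facets omitting a face other than the top one occur in exactly two flags, which differ by a
transposition of the order of coordinates. -/
theorem sum_altMultiset_erase_inner {n : ℕ} (f : Finset (Fin n) × Finset (Fin n) → ℕ ×ₗ Bool)
    (b : Bool) {d : ℕ} {I : Finset (Fin n)} {i j : Fin n} (hij : (j : ℕ) = i + 1)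
    (hj : (j : ℕ) < d) :
    ∑ p ∈ hemisphereFlags n d, altMultiset b (flagLabels f (I.erase i) p) = 0 := by
  have hne : i ≠ j := by
    rintro rfl
    omega
  refine Finset.sum_involution (fun p _ => (p.1 * Equiv.swap i j, p.2)) ?_ ?_ ?_ ?_
  · intro p _
    have : flagLabels f (I.erase i) (p.1 * Equiv.swap i j, p.2) = flagLabels f (I.erase i) p := by
      refine flagLabels_congr fun l hl => ?_
      have hli : l ≠ i := (Finset.mem_erase.mp hl).1
      refine flagFace_congr (fun a => ?_) (fun _ _ => rfl)
      have hsymm : (p.1 * Equiv.swap i j).symm a = Equiv.swap i j (p.1.symm a) := rfl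
      rw [hsymm]
      have hli' : (l : ℕ) ≠ i := fun h => hli (Fin.ext h)
      simp only [Equiv.swap_apply_def]
      split_ifs with h1 h2
      · rw [h1, Fin.le_def, Fin.le_def]; omega
      · rw [h2, Fin.le_def, Fin.le_def]; omega
      · rfl
    rw [this, CharTwo.add_self_eq_zero]
  · intro p _ _ h
    have h1 : p.1 * Equiv.swap i j = p.1 := congrArg Prod.fst h
    rw [mul_eq_left, Equiv.swap_eq_one_iff] at h1
    exact hne h1
  · intro p hp
    rw [mem_hemisphereFlags] at hp ⊢
    refine ⟨fun l hl => ?_, hp.2⟩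
    have h1 : l ≠ i := by rintro rfl; omega
    have h2 : l ≠ j := by rintro rfl; omega
    simp only [Equiv.Perm.mul_apply, Equiv.swap_apply_of_ne_of_ne h1 h2]
    exact hp.1 l hl
  · intro p _
    simp [mul_assoc]

/-- The facets omitting the top face: those that miss a coordinate other than the last one occur
twice, and the others make up the boundary of the hemisphere, a sphere of dimension one less. -/
theorem sum_altMultiset_erase_top {n : ℕ} {f : Finset (Fin n) × Finset (Fin n) → ℕ ×ₗ Bool}
    (hf : IsTuckerLabelling f) (b : Bool) {d : ℕ} (hd : 1 ≤ d) (hdn : d < n) :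
    ∑ p ∈ hemisphereFlags n (d + 1), altMultiset b (flagLabels f (firstIndices n d) p)
      = ∑ p ∈ hemisphereFlags n d, (altMultiset b (flagLabels f (firstIndices n d) p)
          + altMultiset (!b) (flagLabels f (firstIndices n d) p)) := by
  set e : Fin n := ⟨d, hdn⟩ with he
  set e' : Fin n := ⟨d - 1, by omega⟩ with he'
  set F : Equiv.Perm (Fin n) × (Fin n → Bool) → ZMod 2 :=
    fun p => altMultiset b (flagLabels f (firstIndices n d) p) with hF
  have hin : ∀ {p : Equiv.Perm (Fin n) × (Fin n → Bool)},
      (∀ i : Fin n, d ≤ i → p.1 i = i) → ∀ {i : Fin n}, (i : ℕ) < d →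
        ∀ {a : Fin n}, p.1.symm a ≤ i → (a : ℕ) < d := by
    intro p hp i hi a ha
    by_contra hda
    have h1 : p.1.symm a = a := by
      rw [Equiv.symm_apply_eq]
      exact (hp a (by omega)).symm
    rw [h1, Fin.le_def] at ha
    omega
  have hzero : ∑ p ∈ hemisphereFlags n (d + 1) with ¬ p.1 e = e, F p = 0 := by
    refine Finset.sum_involution
      (fun p _ => (p.1, Function.update p.2 (p.1 e) (!p.2 (p.1 e)))) ?_ ?_ ?_ ?_
    · intro p _
      have : flagLabels f (firstIndices n d)
          (p.1, Function.update p.2 (p.1 e) (!p.2 (p.1 e)))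
          = flagLabels f (firstIndices n d) p := by
        refine flagLabels_congr fun i hi => ?_
        rw [mem_firstIndices] at hi
        refine flagFace_congr (fun _ => Iff.rfl) (fun a ha => ?_)
        refine Function.update_of_ne ?_ _ _
        rintro rfl
        simp only [Equiv.symm_apply_apply, Fin.le_def, he] at ha
        omega
      simp only [hF, this, CharTwo.add_self_eq_zero]
    · intro p _ _ h
      have h1 := congrFun (congrArg Prod.snd h) (p.1 e)
      simp at h1
    · intro p hp
      rw [Finset.mem_filter, mem_hemisphereFlags] at hp ⊢
      refine ⟨⟨hp.1.1, fun i hi => ?_⟩, hp.2⟩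
      have hne : i ≠ p.1 e := by
        intro h
        rcases Nat.lt_or_ge d i with hlt | hge
        · have h1 := hp.1.1 i hlt
          have h2 : i = e := p.1.injective (h1.trans h)
          rw [h2] at hlt
          exact lt_irrefl _ hlt
        · refine hp.2 (h.symm.trans (Fin.ext ?_))
          simp only [he]
          omega
      simp only [Function.update_of_ne hne]
      exact hp.1.2 i hi
    · intro p _
      simp
  have hpos : ∑ p ∈ (hemisphereFlags n (d + 1)).filter (fun p => p.1 e = e) with p.2 e' = true, F p
      = ∑ p ∈ hemisphereFlags n d, F p := by
    refine Finset.sum_congr ?_ fun _ _ => rfl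
    ext p
    simp only [Finset.mem_filter, mem_hemisphereFlags]
    constructor
    · rintro ⟨⟨⟨h1, h2⟩, h3⟩, h4⟩
      refine ⟨fun i hi => ?_, fun i hi => ?_⟩
      · rcases Nat.lt_or_eq_of_le hi with h | h
        · exact h1 i h
        · rwa [show i = e from Fin.ext h.symm]
      · rcases Nat.lt_or_ge (i : ℕ) d with h | h
        · rwa [show i = e' from Fin.ext (by simp only [he']; omega)]
        · exact h2 i (by omega)
    · rintro ⟨h1, h2⟩
      exact ⟨⟨⟨fun i hi => h1 i (by omega), fun i hi => h2 i (by omega)⟩, h1 e le_rfl⟩,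
        h2 e' (by simp only [he']; omega)⟩
  -- The negative half of the boundary sphere is the antipode of the positive half.
  have hneg : ∑ p ∈ (hemisphereFlags n (d + 1)).filter (fun p => p.1 e = e) with ¬ p.2 e' = true,
      F p = ∑ p ∈ hemisphereFlags n d, altMultiset (!b) (flagLabels f (firstIndices n d) p) := by
    let neg : Equiv.Perm (Fin n) × (Fin n → Bool) → Equiv.Perm (Fin n) × (Fin n → Bool) :=
      fun p => (p.1, fun i => if (i : ℕ) < d then !p.2 i else p.2 i)
    have hnn : ∀ p, neg (neg p) = p := by
      intro p
      refine Prod.ext rfl (funext fun i => ?_)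
      simp only [neg]
      split_ifs <;> simp
    refine Finset.sum_bij' (fun p _ => neg p) (fun p _ => neg p) ?_ ?_ (fun p _ => hnn p)
      (fun p _ => hnn p) ?_
    · intro p hp
      simp only [Finset.mem_filter, mem_hemisphereFlags] at hp ⊢
      obtain ⟨⟨⟨h1, h2⟩, h3⟩, h4⟩ := hp
      refine ⟨fun i hi => ?_, fun i hi => ?_⟩
      · rcases Nat.lt_or_eq_of_le hi with h | h
        · exact h1 i h
        · rwa [show i = e from Fin.ext h.symm]
      · rcases Nat.lt_or_ge (i : ℕ) d with h | h
        · rw [show i = e' from Fin.ext (by simp only [he']; omega)]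
          have : (e' : ℕ) < d := by simp only [he']; omega
          simpa [neg, this] using h4
        · simpa [neg, Nat.not_lt.mpr h] using h2 i (by omega)
    · intro p hp
      rw [mem_hemisphereFlags] at hp
      simp only [Finset.mem_filter, mem_hemisphereFlags]
      refine ⟨⟨⟨fun i hi => hp.1 i (by omega), fun i hi => ?_⟩, hp.1 e le_rfl⟩, ?_⟩
      · have : ¬ (i : ℕ) < d := by omega
        simpa [neg, this] using hp.2 i (by omega)
      · have h' : (e' : ℕ) < d := by simp only [he']; omega
        have := hp.2 e' (by simp only [he']; omega)
        simp [neg, h', this]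
    · intro p hp
      simp only [Finset.mem_filter, mem_hemisphereFlags] at hp
      obtain ⟨⟨⟨h1, h2⟩, h3⟩, h4⟩ := hp
      have hfix : ∀ i : Fin n, d ≤ i → p.1 i = i := by
        intro i hi
        rcases Nat.lt_or_eq_of_le hi with h | h
        · exact h1 i h
        · rwa [show i = e from Fin.ext h.symm]
      have : flagLabels f (firstIndices n d) (neg p)
          = (flagLabels f (firstIndices n d) p).map flipSign := by
        rw [flagLabels, flagLabels, Multiset.map_map]
        refine Multiset.map_congr rfl fun i hi => ?_
        have hi' : (i : ℕ) < d := mem_firstIndices.mp hi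
        rw [Function.comp_apply, ← hf.antipodal _ (isSignVector_flagFace ..),
          ← flagFace_swap (t := (neg p).2)]
        intro a ha
        simp [neg, hin hfix hi' ha]
      rw [this, altMultiset_map_flipSign _ _ (flagLabels_not_complementary hf _ _), Bool.not_not]
  rw [← Finset.sum_filter_add_sum_filter_not _ (fun p => p.1 e = e), hzero, add_zero,
    ← Finset.sum_filter_add_sum_filter_not _ (fun p => p.2 e' = true), hpos, hneg,
    Finset.sum_add_distrib]

/-- The number of alternating flags of maximal dimension in a hemisphere is odd. -/
theorem sum_altMultiset_hemisphereFlags {n : ℕ}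
    {f : Finset (Fin n) × Finset (Fin n) → ℕ ×ₗ Bool} (hf : IsTuckerLabelling f) {d : ℕ}
    (hd : 1 ≤ d) (hdn : d ≤ n) :
    ∑ p ∈ hemisphereFlags n d, (altMultiset true (flagLabels f (firstIndices n d) p)
      + altMultiset false (flagLabels f (firstIndices n d) p)) = 1 := by
  induction d, hd using Nat.le_induction with
  | base =>
    have h1 : hemisphereFlags n 1 = {(1, fun _ => true)} := by
      ext p
      rw [mem_hemisphereFlags, Finset.mem_singleton]
      constructor
      · rintro ⟨h1, h2⟩
        refine Prod.ext ?_ (funext fun i => h2 i (by omega))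
        have hfix : ∀ i : Fin n, i ≠ ⟨0, hdn⟩ → p.1 i = i := fun i hi =>
          h1 i (Nat.one_le_iff_ne_zero.mpr fun h => hi (Fin.ext h))
        refine Equiv.ext fun i => ?_
        by_cases hi : i = ⟨0, hdn⟩
        · by_contra hne
          have h3 := hfix (p.1 i) (by rw [← hi]; exact hne)
          exact hne (p.1.injective h3)
        · exact hfix i hi
      · rintro rfl
        simp
    have h2 : firstIndices n 1 = {⟨0, hdn⟩} := by
      ext i
      rw [mem_firstIndices, Finset.mem_singleton, Fin.ext_iff]
      simp
    rw [h1, h2, Finset.sum_singleton, flagLabels, Finset.singleton_val, Multiset.map_singleton]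
    simp only [altMultiset, Multiset.sort_singleton, altList]
    cases (ofLex (f (flagFace 1 (fun _ => true) ⟨0, hdn⟩))).2 <;> simp
  | succ d hd ih =>
    rw [← ih (by omega)]
    have h1 := sum_altMultiset_erase_top hf true hd hdn
    rw [Bool.not_true] at h1
    rw [← h1]
    have h2 : ∀ p, altMultiset true (flagLabels f (firstIndices n (d + 1)) p)
        + altMultiset false (flagLabels f (firstIndices n (d + 1)) p)
        = ∑ i ∈ firstIndices n (d + 1),
          altMultiset true (flagLabels f ((firstIndices n (d + 1)).erase i) p) := fun p =>
      (sum_altMultiset_flagLabels_erase f _ p true).symm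
    rw [Finset.sum_congr rfl fun p _ => h2 p, Finset.sum_comm,
      Finset.sum_eq_single (⟨d, hdn⟩ : Fin n)]
    · have h3 : (firstIndices n (d + 1)).erase ⟨d, hdn⟩ = firstIndices n d := by
        ext i
        rw [Finset.mem_erase, mem_firstIndices, mem_firstIndices, Ne, Fin.ext_iff]
        simp only
        omega
      rw [h3]
    · intro i hi hne
      rw [mem_firstIndices] at hi
      have hid : (i : ℕ) ≠ d := fun h => hne (Fin.ext h)
      exact sum_altMultiset_erase_inner f true (i := i) (j := ⟨i + 1, by omega⟩) rfl
        (by simp only; omega)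
    · intro h
      simp [mem_firstIndices] at h

/-- The octahedral Tucker lemma: a Tucker labelling of the sign vectors of length `n` uses a colour
that is at least `n - 1`. -/
theorem IsTuckerLabelling.exists_le_color {n : ℕ}
    {f : Finset (Fin n) × Finset (Fin n) → ℕ ×ₗ Bool} (hf : IsTuckerLabelling f) (hn : 0 < n) :
    ∃ X, IsSignVector X ∧ n ≤ (ofLex (f X)).1 + 1 := by
  have hsum := sum_altMultiset_hemisphereFlags hf hn le_rfl
  obtain ⟨p, _, hp⟩ := Finset.exists_ne_zero_of_sum_ne_zero
    (hsum.trans_ne (one_ne_zero : (1 : ZMod 2) ≠ 0))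
  obtain ⟨b, hb⟩ : ∃ b, altMultiset b (flagLabels f (firstIndices n n) p) ≠ 0 := by
    by_contra! h
    exact hp (by rw [h, h, add_zero])
  have hcard : Multiset.card (flagLabels f (firstIndices n n) p) = n := by
    rw [flagLabels, Multiset.card_map, Finset.card_val, firstIndices,
      Finset.filter_true_of_mem (fun i _ => i.2), Finset.card_univ, Fintype.card_fin]
  obtain ⟨x, hx, hle⟩ := exists_card_le_color_of_altMultiset_ne_zero b _
    (flagLabels_not_complementary hf _ _) hb (by rw [← Multiset.card_pos, hcard]; exact hn)
  obtain ⟨i, _, rfl⟩ := Multiset.mem_map.mp hx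
  exact ⟨_, isSignVector_flagFace .., by rwa [hcard] at hle⟩

/-! ### Colourings of Kneser graphs and of their compatibility graphs -/

theorem eq_ofAdd_one_of_ne_one {g : Multiplicative (ZMod 2)} (hg : g ≠ 1) :
    g = Multiplicative.ofAdd 1 := by
  revert g
  decide

/-- A vertex `A` of the compatibility graph receives the least colour occurring in `A 0`. -/
theorem homCompatibilityGraph_two_colorable {W : Type*} {H : SimpleGraph W} {m : ℕ}
    (hH : H.Colorable m) : (homCompatibilityGraph 2 H).Colorable m := by
  obtain ⟨c⟩ := hH
  have hmin : ∀ x : HomCompletePoset 2 H, ∃ v ∈ x.1 0, ∀ w ∈ x.1 0, c v ≤ c w := by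
    intro x
    obtain ⟨_, ⟨v, hv, rfl⟩, h⟩ :=
      (wellFounded_lt (α := Fin m)).has_min (c '' x.1 0) ((x.2.1 0).image c)
    exact ⟨v, hv, fun w hw => not_lt.mp (h _ ⟨w, hw, rfl⟩)⟩
  choose r hr hle using hmin
  refine ⟨SimpleGraph.Coloring.mk (fun x => c (r x)) ?_⟩
  intro x y hxy
  obtain ⟨g, hg, h⟩ := (compatibilityGraph_homCompletePoset_adj 2 H x y).mp hxy
  rw [eq_ofAdd_one_of_ne_one hg] at h
  have h01 : (⊤ : SimpleGraph (ZMod 2)).Adj 0 1 := by decide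
  rcases h with h | h
  · have h1 : r x ∈ y.1 1 := h 0 (hr x)
    exact (c.valid (y.2.2 0 1 h01 _ (hr y) _ h1)).symm
  · have h1 : r y ∈ x.1 1 := h 1 (hr y)
    exact c.valid (x.2.2 0 1 h01 _ (hr x) _ h1)

/-- A set is coloured by its least element, except that the sets inside the last `2 * k - 1` points,
any two of which meet, all receive the same colour. -/
theorem kneserGraph_colorable {n k : ℕ} (hk : 1 ≤ k) (hn : 2 * k - 1 ≤ n) :
    (kneserGraph n k).Colorable (n + 2 - 2 * k) := by
  have hne : ∀ s : {s : Finset (Fin n) // s.card = k}, s.1.Nonempty := fun s =>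
    Finset.card_pos.mp (by rw [s.2]; exact hk)
  refine ⟨SimpleGraph.Coloring.mk
    (fun s => (⟨min (s.1.min' (hne s) : ℕ) (n + 1 - 2 * k), by omega⟩ : Fin (n + 2 - 2 * k))) ?_⟩
  intro s t hst heq
  obtain ⟨-, hdisj⟩ := hst
  have heq' : min (s.1.min' (hne s) : ℕ) (n + 1 - 2 * k)
      = min (t.1.min' (hne t) : ℕ) (n + 1 - 2 * k) := congrArg Fin.val heq
  by_cases hmin : (s.1.min' (hne s) : ℕ) = t.1.min' (hne t)
  · exact Finset.disjoint_left.mp hdisj (s.1.min'_mem (hne s))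
      (by rw [Fin.ext hmin]; exact t.1.min'_mem (hne t))
  · have hs : n + 1 - 2 * k ≤ (s.1.min' (hne s) : ℕ) := by omega
    have ht : n + 1 - 2 * k ≤ (t.1.min' (hne t) : ℕ) := by omega
    have hsub : (s.1 ∪ t.1).map Fin.valEmbedding ⊆ Finset.Ico (n + 1 - 2 * k) n := by
      intro j hj
      obtain ⟨a, ha, rfl⟩ := Finset.mem_map.mp hj
      rw [Finset.mem_Ico]
      refine ⟨?_, a.2⟩
      rcases Finset.mem_union.mp ha with h | h
      · exact hs.trans (s.1.min'_le a h)
      · exact ht.trans (t.1.min'_le a h)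
    have hcard := Finset.card_le_card hsub
    rw [Finset.card_map, Finset.card_union_of_disjoint hdisj, s.2, t.2, Nat.card_Ico] at hcard
    omega

/-! ### The lower bound -/

/-- The sign vectors `(P, N)` in which both supports contain a `k`-element set. -/
def IsBalanced {n : ℕ} (k : ℕ) (X : Finset (Fin n) × Finset (Fin n)) : Prop :=
  Disjoint X.1 X.2 ∧ k ≤ X.1.card ∧ k ≤ X.2.card

theorem IsBalanced.swap {n k : ℕ} {X : Finset (Fin n) × Finset (Fin n)} (h : IsBalanced k X) :
    IsBalanced k X.swap :=
  ⟨h.1.symm, h.2.2, h.2.1⟩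

/-- The element of the Hom poset formed by the `k`-subsets of the two supports of a balanced sign
vector. -/
def IsBalanced.toHom {n k : ℕ} (hk : 1 ≤ k) {X : Finset (Fin n) × Finset (Fin n)}
    (h : IsBalanced k X) : HomCompletePoset 2 (kneserGraph n k) :=
  ⟨fun i => {s | s.1 ⊆ if i = 0 then X.1 else X.2}, by
    constructor
    · intro i
      have hc : k ≤ (if i = 0 then X.1 else X.2).card := by
        split_ifs
        exacts [h.2.1, h.2.2]
      obtain ⟨s, hs, hcard⟩ := Finset.exists_subset_card_eq hc
      exact ⟨⟨s, hcard⟩, hs⟩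
    · intro i j hij s hs t ht
      have hij' : i ≠ j := hij
      have hd : Disjoint (if i = 0 then X.1 else X.2) (if j = 0 then X.1 else X.2) := by
        have h2 : ∀ i j : ZMod 2, i ≠ j → (i = 0 ∧ j ≠ 0) ∨ (i ≠ 0 ∧ j = 0) := by decide
        rcases h2 i j hij' with ⟨h3, h4⟩ | ⟨h3, h4⟩
        · rw [if_pos h3, if_neg h4]
          exact h.1
        · rw [if_neg h3, if_pos h4]
          exact h.1.symm
      have hst : Disjoint s.1 t.1 := hd.mono hs ht
      refine ⟨?_, hst⟩
      rintro rfl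
      have h0 : s.1 = ∅ := Finset.disjoint_self_iff_empty _ |>.mp hst
      have := s.2
      rw [h0, Finset.card_empty] at this
      omega⟩

theorem IsBalanced.adj_toHom_swap {n k : ℕ} (hk : 1 ≤ k)
    {X Y : Finset (Fin n) × Finset (Fin n)} (hX : IsBalanced k X) (hY : IsBalanced k Y)
    (hXY : X ≤ Y) :
    (homCompatibilityGraph 2 (kneserGraph n k)).Adj (hX.toHom hk) (hY.swap.toHom hk) := by
  rw [compatibilityGraph_homCompletePoset_adj]
  refine ⟨Multiplicative.ofAdd 1, by decide, Or.inl ?_⟩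
  intro i s hs
  have hs' : s.1 ⊆ if i = 0 then X.1 else X.2 := hs
  change s.1 ⊆ if i + 1 = 0 then Y.2 else Y.1
  have h2 : ∀ i : ZMod 2, (i = 0 ∧ i + 1 ≠ 0) ∨ (i ≠ 0 ∧ i + 1 = 0) := by decide
  rcases h2 i with ⟨h3, h4⟩ | ⟨h3, h4⟩
  · rw [if_pos h3] at hs'
    rw [if_neg h4]
    exact hs'.trans hXY.1
  · rw [if_neg h3] at hs'
    rw [if_pos h4]
    exact hs'.trans hXY.2

open Classical in
/-- The labelling of sign vectors induced by a function `c` on them, which is to come from a proper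
colouring of the compatibility graph. Balanced vectors use the smaller of the colours of `X` and its
antipode, shifted by `2 * k - 1`. Of the remaining vectors, those with at most `2 * k - 2` nonzero
coordinates are labelled by their size, with the sign of the first nonzero coordinate, and the
others, which have exactly one support of size at least `k`, by that support. -/
noncomputable def kneserLabel {n : ℕ} (k : ℕ) (c : Finset (Fin n) × Finset (Fin n) → ℕ)
    (X : Finset (Fin n) × Finset (Fin n)) : ℕ ×ₗ Bool :=
  if k ≤ X.1.card ∧ k ≤ X.2.card then
    toLex (2 * k - 1 + min (c X) (c X.swap), decide (c X < c X.swap))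
  else if X.1.card + X.2.card ≤ 2 * k - 2 then
    toLex (X.1.card + X.2.card - 1, decide (∃ a ∈ X.1, ∀ b ∈ X.2, a < b))
  else toLex (2 * k - 2, decide (k ≤ X.1.card))

theorem exists_first_swap {n : ℕ} {X : Finset (Fin n) × Finset (Fin n)} (hX : IsSignVector X) :
    (∃ a ∈ X.2, ∀ b ∈ X.1, a < b) ↔ ¬ ∃ a ∈ X.1, ∀ b ∈ X.2, a < b := by
  constructor
  · rintro ⟨a, ha, h⟩ ⟨b, hb, h'⟩
    exact lt_asymm (h b hb) (h' a ha)
  · intro h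
    obtain ⟨a, ha, hmin⟩ := Finset.exists_min_image (X.1 ∪ X.2) id hX.2
    simp only [id] at hmin
    have hne : ∀ x ∈ X.1, ∀ y ∈ X.2, x ≠ y := fun x hx y hy hxy =>
      Finset.disjoint_left.mp hX.1 hx (hxy ▸ hy)
    rcases Finset.mem_union.mp ha with h1 | h2
    · exact absurd ⟨a, h1, fun b hb =>
        lt_of_le_of_ne (hmin b (Finset.mem_union_right _ hb)) (hne a h1 b hb)⟩ h
    · exact ⟨a, h2, fun b hb =>
        lt_of_le_of_ne (hmin b (Finset.mem_union_left _ hb)) (hne b hb a h2).symm⟩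

theorem isTuckerLabelling_kneserLabel {n k : ℕ} (hk : 1 ≤ k)
    {c : Finset (Fin n) × Finset (Fin n) → ℕ}
    (hc : ∀ X Y, IsBalanced k X → IsBalanced k Y → X ≤ Y → c X ≠ c Y.swap) :
    IsTuckerLabelling (kneserLabel k c) := by
  constructor
  · intro X hX
    unfold kneserLabel flipSign
    simp only [Prod.fst_swap, Prod.snd_swap, Prod.swap_swap]
    by_cases h1 : k ≤ X.1.card ∧ k ≤ X.2.card
    · rw [if_pos h1, if_pos h1.symm, min_comm]
      have := hc X X ⟨hX.1, h1⟩ ⟨hX.1, h1⟩ le_rfl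
      congr 2
      simp only [ofLex_toLex, ← decide_not, decide_eq_decide]
      omega
    · rw [if_neg h1, if_neg (fun h => h1 h.symm), add_comm X.2.card]
      by_cases h2 : X.1.card + X.2.card ≤ 2 * k - 2
      · simp only [if_pos h2, ofLex_toLex, exists_first_swap hX, decide_not]
      · simp only [if_neg h2, ofLex_toLex, ← decide_not]
        congr 2
        rw [decide_eq_decide]
        omega
  · intro X Y hX hY hXY heq
    have hle1 := Finset.card_le_card hXY.1
    have hle2 := Finset.card_le_card hXY.2
    have hXpos := Finset.card_pos.mpr hX.2
    rw [Finset.card_union_of_disjoint hX.1] at hXpos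
    have hcol := congrArg (fun x => (ofLex x).1) heq
    have hsgn := congrArg (fun x => (ofLex x).2) heq
    unfold kneserLabel flipSign at hcol hsgn
    simp only [ofLex_toLex] at hcol hsgn
    by_cases hX1 : k ≤ X.1.card ∧ k ≤ X.2.card
    · have hY1 : k ≤ Y.1.card ∧ k ≤ Y.2.card := ⟨hX1.1.trans hle1, hX1.2.trans hle2⟩
      simp only [if_pos hX1, if_pos hY1, ofLex_toLex, ← decide_not, decide_eq_decide] at hcol hsgn
      have h1 := hc X Y ⟨hX.1, hX1⟩ ⟨hY.1, hY1⟩ hXY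
      have h2 := hc X.swap Y.swap (IsBalanced.swap ⟨hX.1, hX1⟩) (IsBalanced.swap ⟨hY.1, hY1⟩)
        ⟨hXY.2, hXY.1⟩
      rw [Prod.swap_swap] at h2
      omega
    · by_cases hY1 : k ≤ Y.1.card ∧ k ≤ Y.2.card
      · simp only [if_neg hX1, if_pos hY1] at hcol
        split_ifs at hcol <;> simp only [ofLex_toLex] at hcol <;> omega
      · simp only [if_neg hX1, if_neg hY1] at hcol hsgn
        by_cases hX2 : X.1.card + X.2.card ≤ 2 * k - 2
        · by_cases hY2 : Y.1.card + Y.2.card ≤ 2 * k - 2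
          · simp only [if_pos hX2, if_pos hY2, ofLex_toLex] at hcol hsgn
            have h1 : X.1 = Y.1 := Finset.eq_of_subset_of_card_le hXY.1 (by omega)
            have h2 : X.2 = Y.2 := Finset.eq_of_subset_of_card_le hXY.2 (by omega)
            rw [h1, h2] at hsgn
            simp at hsgn
          · simp only [if_pos hX2, if_neg hY2, ofLex_toLex] at hcol
            omega
        · have hY2 : ¬ Y.1.card + Y.2.card ≤ 2 * k - 2 := by omega
          simp only [if_neg hX2, if_neg hY2, ofLex_toLex, ← decide_not, decide_eq_decide] at hsgn
          omega

theorem le_of_homCompatibilityGraph_colorable {n k m : ℕ} (hk : 1 ≤ k) (hn : 2 * k ≤ n)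
    (hm : (homCompatibilityGraph 2 (kneserGraph n k)).Colorable m) : n - 2 * k + 2 ≤ m := by
  classical
  by_contra! hlt
  obtain ⟨C⟩ := hm
  let c : Finset (Fin n) × Finset (Fin n) → ℕ := fun X =>
    if h : IsBalanced k X then (C (h.toHom hk) : ℕ) else 0
  have hcpos : ∀ {X} (h : IsBalanced k X), c X = C (h.toHom hk) := fun h => dif_pos h
  have hc : ∀ X Y, IsBalanced k X → IsBalanced k Y → X ≤ Y → c X ≠ c Y.swap := by
    intro X Y hX hY hXY
    rw [hcpos hX, hcpos hY.swap]
    exact fun h => C.valid (hX.adj_toHom_swap hk hY hXY) (Fin.ext h)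
  obtain ⟨X, hX, hle⟩ := (isTuckerLabelling_kneserLabel hk hc).exists_le_color (by omega)
  unfold kneserLabel at hle
  split_ifs at hle with h1 h2
  · have hb : IsBalanced k X := ⟨hX.1, h1⟩
    -- The colours of `X` and of its antipode differ, so the smaller one is at most `m - 2`.
    have hne := hc X X hb hb le_rfl
    have hlt1 : c X < m := by rw [hcpos hb]; exact Fin.is_lt _
    have hlt2 : c X.swap < m := by rw [hcpos hb.swap]; exact Fin.is_lt _
    simp only [ofLex_toLex] at hle
    omega
  · simp only [ofLex_toLex] at hle
    omega
  · simp only [ofLex_toLex] at hle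
    omega

theorem corollary3p2 (n k : ℕ) (hk : 1 ≤ k) :
    (2 * k ≤ n →
      (homCompatibilityGraph 2 (kneserGraph n k)).chromaticNumber
        = ((n - 2 * k + 2 : ℕ) : ℕ∞)) ∧
    (2 * k - 1 ≤ n →
      (kneserGraph n k).chromaticNumber = ((n + 2 - 2 * k : ℕ) : ℕ∞)) := by
  constructor
  · intro hn
    apply le_antisymm
    · have h := homCompatibilityGraph_two_colorable (kneserGraph_colorable hk (by omega : _ ≤ n))
      rw [Nat.sub_add_comm hn] at h
      exact h.chromaticNumber_le
    · rw [SimpleGraph.le_chromaticNumber_iff_colorable]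
      exact fun m hm => Nat.cast_le.mpr (le_of_homCompatibilityGraph_colorable hk hn hm)
  · intro hn
    apply le_antisymm (kneserGraph_colorable hk hn).chromaticNumber_le
    rw [SimpleGraph.le_chromaticNumber_iff_colorable]
    intro m hm
    rcases Nat.lt_or_ge n (2 * k) with hlt | hge
    · -- Here `n = 2 * k - 1`, and the graph has a vertex but no edge.
      obtain ⟨s, _, hs⟩ := Finset.exists_subset_card_eq (s := (Finset.univ : Finset (Fin n)))
        (n := k) (by rw [Finset.card_univ, Fintype.card_fin]; omega)
      obtain ⟨c⟩ := hm
      have := (c ⟨s, hs⟩).pos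
      have hle : n + 2 - 2 * k ≤ m := by omega
      exact Nat.cast_le.mpr hle
    · have := le_of_homCompatibilityGraph_colorable hk hge (homCompatibilityGraph_two_colorable hm)
      have hle : n + 2 - 2 * k ≤ m := by omega
      exact Nat.cast_le.mpr hle
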